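/- Let $k$ be a field (of arbitrary characteristic, not necessarily algebraically closed), let $X$ be a separated $k$-scheme, and let $R\subset X$ be a closed subscheme which is finite over $k$, supported at the pairwise distinct points $x_1,\dots,x_n$ of $X$ (i.e. $\{x_1,\dots,x_n\}$ is the underlying set of $R$). For each $i$ let $\hat{\mathcal O}_{X,x_i}=\varprojlim_m \mathcal O_{X,x_i}/\mathfrak m_{x_i}^m$. The homomorphisms $\mathcal O_{X,x_i}\to\mathcal O_{R,x_i}$ are surjective and annihilate a power of $\mathfrak m_{x_i}$, hence extend canonically to $\hat{\mathcal O}_{X,x_i}\to\mathcal O_{R,x_i}$; in this way $R=\bigsqcup_i\operatorname{Spec}\mathcal O_{R,x_i}$ is also a closed subscheme of $\bigsqcup_i \operatorname{Spec}\hat{\mathcal O}_{X,x_i}$. For a $k$-scheme $Y$ and a closed subscheme $R\subset Y$ finite over $k$, say that $R$ is *smoothable in $Y$* if there exist an irreducible locally Noetherian $k$-scheme $T$, a $k$-rational point $t$ of $T$ and a closed subscheme $\mathcal Z\subset Y\times_k T$ such that the projection $\mathcal Z\to T$ is finite and flat, its fibre over $t$ is $\mathcal Z_t=R$ as a closed subscheme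 of $Y\times\{t\}=Y$, and its fibre $\mathcal Z_\eta$ over the generic point $\eta$ of $T$ is smooth over (the residue field of) $\eta$. Then $R$ is smoothable in $X$ if and only if $R$ is smoothable in $\bigsqcup_{i=1}^n\operatorname{Spec}\hat{\mathcal O}_{X,x_i}$. -/

import Mathlib

open CategoryTheory CategoryTheory.Limits AlgebraicGeometry

universe u

noncomputable section

namespace Smoothability

variable {k : Type u} [Field k]

/-- `IsAbstractSmoothing g q t p e`: the family `p : Z ⟶ T` over the irreducible `k`-scheme
`q : T ⟶ Spec k` is an abstract smoothing of the `k`-scheme `g : R ⟶ Spec k` with special point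
the `k`-rational point `t` of `T`, where `e : R ⟶ Z` identifies `R` with the fibre of `p` over `t`.
All bases of families are locally Noetherian. -/
structure IsAbstractSmoothing {R T Z : Scheme.{u}} [IrreducibleSpace T]
    (g : R ⟶ Spec (.of k)) (q : T ⟶ Spec (.of k)) (t : Spec (.of k) ⟶ T)
    (p : Z ⟶ T) (e : R ⟶ Z) : Prop where
  /-- the base is locally Noetherian -/
  isLocallyNoetherian : IsLocallyNoetherian T
  /-- `t` is a `k`-rational point of `T` -/
  rational : t ≫ q = 𝟙 _
  /-- the family is finite -/
  isFinite : IsFinite p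
  /-- the family is flat -/
  flat : Flat p
  /-- `R` is the fibre of the family over `t`, as a `k`-scheme -/
  fibre : IsPullback e g p t
  /-- the fibre over the generic point `η` of `T` is smooth over (the residue field of) `η` -/
  smooth_generic : Smooth (p.fiberToSpecResidueField (genericPoint T))

/-- The closed subscheme `i : R ⟶ X` of the `k`-scheme `f : X ⟶ Spec k` is smoothable in `X`:
there are an irreducible `k`-scheme `T` and a closed subscheme `j : Z ⟶ X ×ₖ T` such that `Z ⟶ T`
is an abstract smoothing of `R` whose special fibre, as a subscheme of `X × {t} = X`, is `R`. -/
def IsSmoothableIn {R X : Scheme.{u}} (f : X ⟶ Spec (.of k)) (i : R ⟶ X) : Prop :=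
  ∃ (T Z : Scheme.{u}) (_ : IrreducibleSpace T) (q : T ⟶ Spec (.of k)) (t : Spec (.of k) ⟶ T)
    (j : Z ⟶ pullback f q) (e : R ⟶ Z),
    IsClosedImmersion j ∧
    IsAbstractSmoothing (i ≫ f) q t (j ≫ pullback.snd f q) e ∧
    e ≫ j ≫ pullback.fst f q = i

/-- The completion `lim 𝒪 / 𝔪 ^ n` of the local ring `𝒪` of `X` at `x`. -/
abbrev completedStalk (X : Scheme.{u}) (x : X) : CommRingCat.{u} :=
  .of (AdicCompletion (IsLocalRing.maximalIdeal (X.presheaf.stalk x)) (X.presheaf.stalk x))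

/-- The canonical homomorphism from the local ring at `x` to its completion. -/
def toCompletedStalk (X : Scheme.{u}) (x : X) : X.presheaf.stalk x ⟶ completedStalk X x :=
  CommRingCat.ofHom (algebraMap (X.presheaf.stalk x)
    (AdicCompletion (IsLocalRing.maximalIdeal (X.presheaf.stalk x)) (X.presheaf.stalk x)))

/-- The canonical morphism from the spectrum of the completed local ring at `x` to `X`. -/
def fromSpecCompletedStalk (X : Scheme.{u}) (x : X) : Spec (completedStalk X x) ⟶ X :=
  Spec.map (toCompletedStalk X x) ≫ X.fromSpecStalk x

variable {X : Scheme.{u}} {n : ℕ}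

/-- The disjoint union of the spectra of the completed local rings of `X` at `x 0, x 1, …`. -/
abbrev formalNbhd (x : Fin n → X) : Scheme.{u} :=
  ∐ fun a : Fin n => Spec (completedStalk X (x a))

/-- The canonical morphism from the disjoint union of the spectra of completed local rings. -/
def formalNbhdTo (x : Fin n → X) : formalNbhd x ⟶ X :=
  Sigma.desc fun a => fromSpecCompletedStalk X (x a)

/-! ### Lifting a finite subscheme to the formal neighbourhood of its support -/

section LocalLift

variable {A B : Type u} [CommRing A] [IsLocalRing A] [CommRing B] [IsLocalRing B] [IsArtinianRing B]

open IsLocalRing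

lemma exists_pow_map_eq_zero (φ : A →+* B) [IsLocalHom φ] :
    ∃ N : ℕ, ∀ a ∈ maximalIdeal A ^ N, φ a = 0 := by
  obtain ⟨N, hN⟩ := (IsArtinianRing.isNilpotent_jacobson_bot (R := B))
  refine ⟨N, fun a ha => ?_⟩
  have h1 : φ a ∈ (maximalIdeal A ^ N).map φ := Ideal.mem_map_of_mem φ ha
  rw [Ideal.map_pow] at h1
  have h2 : (maximalIdeal A).map φ ≤ maximalIdeal B :=
    ((local_hom_TFAE φ).out 0 2).mp ‹IsLocalHom φ›
  have h3 := Ideal.pow_right_mono h2 N h1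
  rw [← jacobson_eq_maximalIdeal ⊥ bot_ne_top, hN] at h3
  simpa using h3

/-- The continuous extension to the completion of a local homomorphism from a local ring to an
Artinian local ring. -/
def completionLift (φ : A →+* B) [IsLocalHom φ] : AdicCompletion (maximalIdeal A) A →+* B :=
  (Ideal.Quotient.lift _ φ (exists_pow_map_eq_zero φ).choose_spec).comp
    (AdicCompletion.evalₐ (maximalIdeal A) (exists_pow_map_eq_zero φ).choose :
      AdicCompletion (maximalIdeal A) A →+* _)

lemma completionLift_comp_algebraMap (φ : A →+* B) [IsLocalHom φ] :
    (completionLift φ).comp (algebraMap A (AdicCompletion (maximalIdeal A) A)) = φ := by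
  ext a
  simp [completionLift]

end LocalLift

section Cover

lemma isIso_germ_singleton (R : Scheme.{u}) (r : R) (U : R.Opens) (hr : r ∈ U) (hU : ∀ s ∈ U, s = r) :
    IsIso (R.presheaf.germ U r hr) := by
  have hle (W : R.Opens) (hW : r ∈ W) : U ≤ W := fun s hs => (hU s hs).symm ▸ hW
  rw [ConcreteCategory.isIso_iff_bijective]
  refine ⟨fun s t hst => ?_, fun s => ?_⟩
  · obtain ⟨W, hW, i₁, i₂, e⟩ := R.presheaf.germ_eq r hr hr s t hst
    have hWU : W = U := le_antisymm i₁.le (hle W hW)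
    subst hWU
    have h₁ : i₁ = 𝟙 _ := Subsingleton.elim _ _
    have h₂ : i₂ = 𝟙 _ := Subsingleton.elim _ _
    subst h₁ h₂
    simpa using e
  · obtain ⟨W, hW, t, rfl⟩ := R.presheaf.exists_germ_eq s
    exact ⟨R.presheaf.map (homOfLE (hle W hW)).op t, R.presheaf.germ_res_apply _ _ _ _⟩

variable (R : Scheme.{u}) [IsLocallyArtinian R]

instance isOpenImmersion_fromSpecStalk (r : R) : IsOpenImmersion (R.fromSpecStalk r) := by
  let U : R.Opens := ⟨{r}, isOpen_discrete _⟩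
  have hU : IsAffineOpen U := .of_subsingleton Set.subsingleton_singleton
  have hr : r ∈ U := Set.mem_singleton r
  have := isIso_germ_singleton R r U hr fun s hs => hs
  rw [← hU.fromSpecStalk_eq_fromSpecStalk hr, IsAffineOpen.fromSpecStalk]
  infer_instance

instance isArtinianRing_stalk (r : R) : IsArtinianRing (R.presheaf.stalk r) := by
  have : IsLocallyArtinian (Spec (R.presheaf.stalk r)) := .of_isImmersion (R.fromSpecStalk r)
  exact Scheme.isLocallyArtinianScheme_Spec.mp this

/-- A locally Artinian scheme is covered by the spectra of its local rings. -/
def stalkCover : R.OpenCover where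
  I₀ := R
  X r := Spec (R.presheaf.stalk r)
  f r := R.fromSpecStalk r
  mem₀ := by
    rw [Scheme.presieve₀_mem_precoverage_iff]
    exact ⟨fun r => ⟨r, IsLocalRing.closedPoint _, Scheme.fromSpecStalk_closedPoint⟩, inferInstance⟩

lemma pullback_fst_eq_snd {Y : Scheme.{u}} (φ : ∀ r : R, Spec (R.presheaf.stalk r) ⟶ Y) (r s : R) :
    pullback.fst (R.fromSpecStalk r) (R.fromSpecStalk s) ≫ φ r =
      pullback.snd (R.fromSpecStalk r) (R.fromSpecStalk s) ≫ φ s := by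
  by_cases hrs : r = s
  · subst hrs
    rw [(cancel_mono (R.fromSpecStalk r)).mp pullback.condition]
  · have hE : IsEmpty (pullback (R.fromSpecStalk r) (R.fromSpecStalk s) : Scheme.{u}) := by
      refine ⟨fun z => hrs ?_⟩
      have hz : ∀ t : R, ∀ y, R.fromSpecStalk t y = t := fun t y => by
        have : R.fromSpecStalk t y ∈ Set.range (R.fromSpecStalk t) := ⟨y, rfl⟩
        rw [Scheme.range_fromSpecStalk] at this
        exact this.eq
      refine (hz r (pullback.fst (R.fromSpecStalk r) (R.fromSpecStalk s) z)).symm.trans (.trans ?_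
        (hz s (pullback.snd (R.fromSpecStalk r) (R.fromSpecStalk s) z)))
      rw [← Scheme.Hom.comp_apply, ← Scheme.Hom.comp_apply, pullback.condition]
    exact (isInitialOfIsEmpty (X := pullback (R.fromSpecStalk r) (R.fromSpecStalk s))).hom_ext _ _

end Cover

lemma isLocallyArtinian_of_isFinite {R : Scheme.{u}} (f : X ⟶ Spec (.of k)) (i : R ⟶ X)
    [IsFinite (i ≫ f)] : IsLocallyArtinian R :=
  .of_locallyQuasiFinite (i ≫ f)

variable {R : Scheme.{u}} (f : X ⟶ Spec (.of k)) (i : R ⟶ X) (x : Fin n → X)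

/-- The local homomorphism `𝒪_{X, y} ⟶ 𝒪_{R, r}` for `y = i r`. -/
def stalkHom (r : R) {y : X} (e : y = i r) : X.presheaf.stalk y ⟶ R.presheaf.stalk r :=
  X.presheaf.stalkSpecializes (specializes_of_eq e.symm) ≫ i.stalkMap r

instance isLocalHom_stalkHom (r : R) {y : X} (e : y = i r) : IsLocalHom (stalkHom i r e).hom := by
  subst e
  rw [stalkHom, TopCat.Presheaf.stalkSpecializes_refl, Category.id_comp]
  infer_instance

/-- The continuous extension `𝒪^_{X, y} ⟶ 𝒪_{R, r}` of `𝒪_{X, y} ⟶ 𝒪_{R, r}` for `y = i r`. -/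
def completedStalkHom [IsLocallyArtinian R] (r : R) {y : X} (e : y = i r) :
    completedStalk X y ⟶ R.presheaf.stalk r :=
  CommRingCat.ofHom (completionLift (A := X.presheaf.stalk y) (B := R.presheaf.stalk r)
    (stalkHom i r e).hom)

lemma toCompletedStalk_completedStalkHom [IsLocallyArtinian R] (r : R) {y : X} (e : y = i r) :
    toCompletedStalk X y ≫ completedStalkHom i r e = stalkHom i r e :=
  CommRingCat.hom_ext (completionLift_comp_algebraMap (A := X.presheaf.stalk y)
    (B := R.presheaf.stalk r) (stalkHom i r e).hom)

variable (h : Set.range i = Set.range x)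

/-- The index of the point of the support of `R` at which `r : R` lies. -/
def supportIndex (r : R) : Fin n :=
  (h.le (Set.mem_range_self r)).choose

lemma supportIndex_spec (r : R) : x (supportIndex i x h r) = i r :=
  (h.le (Set.mem_range_self r)).choose_spec

/-- The component at `r` of the lift of `i : R ⟶ X` to the formal neighbourhood: the morphism given
by the extension of `𝒪_{X, i r} ⟶ 𝒪_{R, r}` to the completion. -/
def formalLiftAt [IsLocallyArtinian R] (r : R) : Spec (R.presheaf.stalk r) ⟶ formalNbhd x :=
  Spec.map (completedStalkHom i r (supportIndex_spec i x h r)) ≫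
    Sigma.ι (fun a : Fin n => Spec (completedStalk X (x a))) (supportIndex i x h r)

lemma formalLiftAt_formalNbhdTo [IsLocallyArtinian R] (r : R) :
    formalLiftAt i x h r ≫ formalNbhdTo x = R.fromSpecStalk r ≫ i := by
  simp only [formalLiftAt, formalNbhdTo, Category.assoc, colimit.ι_desc, Cofan.mk_ι_app]
  rw [fromSpecCompletedStalk, ← Spec.map_comp_assoc, toCompletedStalk_completedStalkHom, stalkHom,
    Spec.map_comp_assoc, Scheme.SpecMap_stalkSpecializes_fromSpecStalk,
    Scheme.SpecMap_stalkMap_fromSpecStalk]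

/-- A subscheme `i : R ⟶ X`, finite over `k` and supported at the points `x a`, viewed as a
subscheme of the disjoint union of the spectra of the completed local rings at these points. -/
def formalLift [IsFinite (i ≫ f)] : R ⟶ formalNbhd x :=
  have := isLocallyArtinian_of_isFinite f i
  (stalkCover R).glueMorphisms (formalLiftAt i x h) (pullback_fst_eq_snd R _)

lemma formalLift_formalNbhdTo [IsFinite (i ≫ f)] : formalLift f i x h ≫ formalNbhdTo x = i := by
  have := isLocallyArtinian_of_isFinite f i
  refine Scheme.Cover.hom_ext (stalkCover R) _ _ fun r => ?_
  have e := Scheme.Cover.ι_glueMorphisms (stalkCover R) (formalLiftAt i x h)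
    (pullback_fst_eq_snd R _) r
  rw [← Category.assoc]
  exact (congrArg (· ≫ formalNbhdTo x) e).trans (formalLiftAt_formalNbhdTo i x h r)

instance isClosedImmersion_formalLift [IsFinite (i ≫ f)] [IsClosedImmersion i] :
    IsClosedImmersion (formalLift f i x h) := by
  have : IsClosedImmersion (formalLift f i x h ≫ formalNbhdTo x) := by
    rwa [formalLift_formalNbhdTo]
  exact .of_comp _ (formalNbhdTo x)

end Smoothability

end

/-! Both directions start by base change along a morphism `Spec A ⟶ T` with `A` local Noetherian,
through which `t` factors and which sends generic point to generic point. The special fibre is then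
unchanged and the generic fibre only undergoes a field extension, so the family remains a smoothing;
being finite over `Spec A`, its total space is now an affine scheme `Spec B`.

From `X` to the formal neighbourhood, `A` is moreover taken complete. Then `B` is complete for `J =
𝔪_A B`, and each `B / J ^ (m + 1)` is Artinian with the same support as `R`. A local homomorphism
from a local ring to an Artinian local ring extends canonically to the completion, so the
truncations lift compatibly to the formal neighbourhood. The latter is affine, hence the lifts
assemble to a morphism from `Spec B` (`exists_lift_formalNbhd`). Its composite with the map to `X`
is the given morphism, because `X` is separated and the powers of `J` intersect in zero.

In the other direction a local base suffices. The family is composed with the map to `X`; on the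
special fibre this gives the closed immersion `i`, in particular a monomorphism. Nakayama's lemma,
applied to the kernel pair, spreads this out to the whole finite family, and a finite monomorphism
is a closed immersion (`isClosedImmersion_of_mono_fibre`). -/

noncomputable section CompleteLocalRings

/-! ### Completions of Noetherian rings -/

open IsLocalRing TensorProduct

/-- Separatedness holds because `I` lies in the Jacobson radical. For precompleteness, the
completion of a finite module is a quotient of `Â ⊗ M`, and here every element of `Â` already comes
from `A`. -/
theorem IsAdicComplete.of_finite_of_isNoetherianRing {A M : Type*} [CommRing A] [IsNoetherianRing A]
    (I : Ideal A) [IsAdicComplete I A] [AddCommGroup M] [Module A M] [Module.Finite A M] :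
    IsAdicComplete I M := by
  have : IsHausdorff I M := IsHausdorff.of_le_jacobson I M (IsAdicComplete.le_jacobson_bot I)
  have : IsPrecomplete I M := by
    rw [← AdicCompletion.of_surjective_iff]
    intro y
    obtain ⟨z, rfl⟩ := AdicCompletion.ofTensorProduct_surjective_of_finite I M y
    induction z with
    | zero => exact ⟨0, by simp⟩
    | add a b ha hb =>
      obtain ⟨a', ha⟩ := ha
      obtain ⟨b', hb⟩ := hb
      exact ⟨a' + b', by rw [map_add, map_add, ha, hb]⟩
    | tmul r m =>
      obtain ⟨s, rfl⟩ := AdicCompletion.of_surjective I A r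
      refine ⟨s • m, ?_⟩
      rw [AdicCompletion.ofTensorProduct_tmul, map_smul]
      ext n
      simp
      rfl
  exact {}

theorem AdicCompletion.exists_forall_evalₐ_eq {A : Type*} [CommRing A] (I : Ideal A) (N : ℕ)
    (x : AdicCompletion I A) : ∃ a : A, ∀ m ≤ N, evalₐ I m x = Ideal.Quotient.mk (I ^ m) a := by
  obtain ⟨r, rfl⟩ := AdicCompletion.mk_surjective I A x
  refine ⟨r N, fun m hm => ?_⟩
  rw [evalₐ_mk]
  exact (AdicCompletion.Ideal.mk_eq_mk I hm r).symm

/-- If `a₁, …, aₙ` generate `I`, then `Xᵢ ↦ aᵢ` extends to a surjection from the Noetherian ring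
`A⟦X₁, …, Xₙ⟧` onto the completion. -/
theorem AdicCompletion.isNoetherianRing {A : Type u} [CommRing A] [IsNoetherianRing A]
    (I : Ideal A) : IsNoetherianRing (AdicCompletion I A) := by
  obtain ⟨n, a, ha⟩ := Submodule.fg_iff_exists_fin_generating_family.mp I.fg_of_isNoetherianRing
  let P := MvPolynomial (Fin n) A
  let J : Ideal P := MvPolynomial.idealOfVars (Fin n) A
  let π : P →+* A := (MvPolynomial.aeval a : P →ₐ[A] A)
  have hJ : J.map π = I := by
    simp only [J, MvPolynomial.idealOfVars, Ideal.map_span, ← ha, ← Set.range_comp]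
    congr 1
    congr 1
    ext i
    exact MvPolynomial.aeval_X a i
  have hJn (n : ℕ) : J ^ n ≤ (I ^ n).comap π := by
    rw [← Ideal.map_le_iff_le_comap, Ideal.map_pow, hJ]
  let S := AdicCompletion J P
  have hJfg : J.FG := by
    classical
    exact ⟨Finset.univ.image MvPolynomial.X, by
      simp [J, P, MvPolynomial.idealOfVars, Set.image_univ]⟩
  have hS : IsNoetherianRing S :=
    isNoetherianRing_of_ringEquiv _ (MvPowerSeries.toAdicCompletionAlgEquiv (Fin n) A).toRingEquiv
  let g (n : ℕ) : S →+* A ⧸ I ^ n :=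
    (Ideal.quotientMap (I ^ n) π (hJn n)).comp (AdicCompletion.evalₐ J n : S →+* P ⧸ J ^ n)
  have hg : ∀ {m n : ℕ} (hle : m ≤ n), (Ideal.Quotient.factorPow I hle).comp (g n) = g m := by
    intro m n hle
    ext x
    obtain ⟨y, hy⟩ := AdicCompletion.exists_forall_evalₐ_eq J n x
    simp [g, hy m hle, hy n le_rfl]
  let f : S →+* AdicCompletion I A := AdicCompletion.liftRingHom I g hg
  have hf : Function.Surjective f := by
    have hfa (p : P) : f (algebraMap P S p) = algebraMap A _ (π p) := by
      refine AdicCompletion.ext_evalₐ fun n => ?_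
      simp [f, AdicCompletion.algebraMap_apply, g]
    have := AdicCompletion.isAdicComplete_self J hJfg
    have hm : (J.map (algebraMap P S)).map f = I.map (algebraMap A (AdicCompletion I A)) := by
      have e : f.comp (algebraMap P S) = (algebraMap A (AdicCompletion I A)).comp π :=
        RingHom.ext hfa
      rw [Ideal.map_map, e, ← Ideal.map_map, hJ]
    have h2 := AdicCompletion.isAdicComplete_self I I.fg_of_isNoetherianRing
    rw [← hm] at h2
    -- Both sides being complete, surjectivity may be tested modulo the ideal of the variables.
    -- There the target is `A / I`, already attained by constant polynomials.
    refine surjective_of_mk_map_comp_surjective (I := J.map (algebraMap P S)) f ?_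
    intro y
    obtain ⟨y, rfl⟩ := Ideal.Quotient.mk_surjective y
    obtain ⟨z, hz⟩ := Ideal.Quotient.mk_surjective (AdicCompletion.evalOneₐ I y)
    refine ⟨algebraMap P S (MvPolynomial.C z), ?_⟩
    rw [RingHom.comp_apply, hfa, Ideal.Quotient.eq, hm,
      ← AdicCompletion.ker_evalOneₐ_eq_map I I.fg_of_isNoetherianRing, RingHom.mem_ker]
    have : π (MvPolynomial.C z) = z := MvPolynomial.aeval_C a z
    rw [this, map_sub]
    simp [AdicCompletion.algebraMap_apply, ← hz]
  exact isNoetherianRing_of_surjective _ _ f hf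

/-- A Noetherian local ring with irreducible spectrum is dominated by a complete Noetherian local
domain, with the same morphisms to a field which are surjective on the source. -/
theorem exists_isAdicComplete_domain (A : Type u) [CommRing A] [IsLocalRing A] [IsNoetherianRing A]
    [h : (nilradical A).IsPrime] : ∃ (B : Type u) (_ : CommRing B) (_ : IsLocalRing B)
      (_ : IsNoetherianRing B) (_ : IsDomain B) (φ : A →+* B),
      IsAdicComplete (maximalIdeal B) B ∧ RingHom.ker φ = nilradical A ∧
        ∀ {κ : Type u} [Field κ] (ε : A →+* κ), Function.Surjective ε →
          ∃ ε' : B →+* κ, ε'.comp φ = ε := by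
  let C := AdicCompletion (maximalIdeal A) A
  have : IsNoetherianRing C := AdicCompletion.isNoetherianRing _
  have hinj : Function.Injective (algebraMap A C) := AdicCompletion.of_injective (maximalIdeal A) A
  have hmin : nilradical A ∈ minimalPrimes A := by
    refine ⟨⟨h, bot_le⟩, fun p hp _ => nilradical_le_prime p (H := hp.1)⟩
  -- The completion need not have irreducible spectrum, so it is cut down to a domain. A minimal
  -- prime of `A` is the contraction of a prime of any ring containing `A`, which keeps the generic
  -- point in the image.
  obtain ⟨q, hq, hqc⟩ :=
    Ideal.exists_comap_eq_of_mem_minimalPrimes_of_injective hinj _ hmin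
  have : Nontrivial (C ⧸ q) := Ideal.Quotient.nontrivial_iff.mpr hq.ne_top
  have hloc : IsLocalRing (C ⧸ q) := .of_surjective' _ Ideal.Quotient.mk_surjective
  refine ⟨C ⧸ q, inferInstance, hloc, inferInstance, inferInstance,
    (Ideal.Quotient.mk q).comp (algebraMap A C), ?_, ?_, fun {κ} _ ε hε => ?_⟩
  · have h1 : IsAdicComplete (maximalIdeal C) (C ⧸ q) := .of_finite_of_isNoetherianRing _
    have h2 := (IsAdicComplete.map_algebraMap_iff (R := C) (S := C ⧸ q) (M := C ⧸ q)
      (I := maximalIdeal C)).mpr h1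
    have hm : (maximalIdeal C).map (algebraMap C (C ⧸ q)) = maximalIdeal (C ⧸ q) :=
      map_maximalIdeal_of_surjective _ Ideal.Quotient.mk_surjective
    rw [← hm]
    exact h2
  · rw [← hqc, ← RingHom.comap_ker, Ideal.mk_ker]
  · have hker : RingHom.ker ε = maximalIdeal A :=
      IsLocalRing.eq_maximalIdeal (RingHom.ker_isMaximal_of_surjective ε hε)
    -- The extension of `ε` to `C` is a surjection onto a field, so its kernel is the maximal ideal,
    -- which contains `q`.
    have hq' : ∀ c ∈ q, (Ideal.Quotient.lift (maximalIdeal A) ε (fun a ha => hker.ge ha)).comp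
        (AdicCompletion.evalOneₐ (maximalIdeal A) : C →+* _) c = 0 := by
      intro c hc
      rw [← RingHom.mem_ker, ker_eq_maximalIdeal]
      · exact le_maximalIdeal hq.ne_top hc
      rw [RingHom.coe_comp]
      exact (Ideal.Quotient.lift_surjective_of_surjective _ (fun a ha => hker.ge ha) hε).comp
        (AdicCompletion.evalOneₐ_surjective _)
    refine ⟨Ideal.Quotient.lift q _ hq', ?_⟩
    ext a
    rw [RingHom.comp_apply, RingHom.comp_apply, Ideal.Quotient.lift_mk]
    exact Ideal.Quotient.lift_mk (maximalIdeal A) ε fun a ha => hker.ge ha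

end CompleteLocalRings

noncomputable section

/-! ### Generic points and base change of smoothings -/

namespace Smoothability

lemma map_genericPoint_of_isGenericPoint {S T : Scheme.{u}} [IrreducibleSpace S]
    [IrreducibleSpace T] (v : S ⟶ T) {ξ : S} (h : IsGenericPoint ξ Set.univ) (hξ : v ξ = genericPoint T) :
    v (genericPoint S) = genericPoint T := by
  rw [← hξ, (genericPoint_spec S).eq h]

lemma isGenericPoint_of_isPreimmersion {S T : Scheme.{u}} [IrreducibleSpace T] (v : S ⟶ T)
    [IsPreimmersion v] {ξ : S} (hξ : v ξ = genericPoint T) : IsGenericPoint ξ Set.univ := by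
  rw [isGenericPoint_iff_specializes]
  refine fun s => ⟨fun _ => trivial, fun _ => v.isEmbedding.isInducing.specializes_iff.mp ?_⟩
  rw [hξ]
  exact (genericPoint_spec T).specializes trivial

lemma _root_.IsGenericPoint.irreducibleSpace {S : Type*} [TopologicalSpace S] {ξ : S}
    (h : IsGenericPoint ξ Set.univ) : IrreducibleSpace S :=
  have := h.isIrreducible
  { isPreirreducible_univ := this.2, toNonempty := ⟨ξ⟩ }

section BaseChange

variable {k : Type u} [Field k] {X R T Z T' Z' : Scheme.{u}} [IrreducibleSpace T]
  [IrreducibleSpace T']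

/-- The condition `hv` makes the new generic fibre a base change of the old one along an extension
of residue fields; the fibre over `t'` is unchanged by pasting of pullback squares. -/
theorem IsAbstractSmoothing.exists_baseChange {g : R ⟶ Spec (.of k)} {q : T ⟶ Spec (.of k)}
    {t : Spec (.of k) ⟶ T} {p : Z ⟶ T} {e : R ⟶ Z} (H : IsAbstractSmoothing g q t p e)
    [IsLocallyNoetherian T'] {v : T' ⟶ T} (hv : v (genericPoint T') = genericPoint T)
    {t' : Spec (.of k) ⟶ T'} (ht : t' ≫ v = t) {b : Z' ⟶ Z} {p' : Z' ⟶ T'}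
    (h : IsPullback b p' p v) :
    ∃ e' : R ⟶ Z', e' ≫ b = e ∧ IsAbstractSmoothing g (v ≫ q) t' p' e' := by
  have hw : e ≫ p = (g ≫ t') ≫ v := by rw [H.fibre.w, Category.assoc, ht]
  refine ⟨h.lift e (g ≫ t') hw, h.lift_fst _ _ hw, ?_⟩
  refine ⟨inferInstance, by rw [reassoc_of% ht, H.rational], ?_, ?_, ?_, ?_⟩
  · exact MorphismProperty.of_isPullback (P := @IsFinite) h H.isFinite
  · exact MorphismProperty.of_isPullback (P := @Flat) h H.flat
  · refine IsPullback.of_right ?_ (h.lift_snd _ _ hw) h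
    rw [h.lift_fst, ht]
    exact H.fibre
  · refine MorphismProperty.of_isPullback (P := @Smooth)
      (isPullback_fiberToSpecResidueField_of_isPullback h (genericPoint T')) ?_
    rw [hv]
    exact H.smooth_generic

omit [IrreducibleSpace T] [IrreducibleSpace T'] in
-- The map `Z' ⟶ X ×ₛ T'` is the base change of `Z ⟶ X ×ₛ T` along `X ×ₛ T' ⟶ X ×ₛ T`.
theorem isClosedImmersion_lift_baseChange {S : Scheme.{u}} {f : X ⟶ S} {q : T ⟶ S}
    {a : Z ⟶ X} {p : Z ⟶ T} (w : a ≫ f = p ≫ q) [IsClosedImmersion (pullback.lift a p w)]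
    {v : T' ⟶ T} {b : Z' ⟶ Z} {p' : Z' ⟶ T'} (h : IsPullback b p' p v)
    (w' : (b ≫ a) ≫ f = p' ≫ v ≫ q) :
    IsClosedImmersion (pullback.lift (b ≫ a) p' w') := by
  let m : pullback f (v ≫ q) ⟶ pullback f q :=
    pullback.lift (pullback.fst _ _) (pullback.snd _ _ ≫ v)
      (by rw [pullback.condition, Category.assoc])
  have hm₁ : m ≫ pullback.fst f q = pullback.fst f (v ≫ q) := pullback.lift_fst _ _ _
  have hm₂ : m ≫ pullback.snd f q = pullback.snd f (v ≫ q) ≫ v := pullback.lift_snd _ _ _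
  have h1 : IsPullback m (pullback.snd f (v ≫ q)) (pullback.snd f q) v := by
    refine IsPullback.of_right (h₁₂ := pullback.fst f q) (v₁₃ := f) (h₂₂ := q) ?_ hm₂
      (IsPullback.of_hasPullback f q)
    rw [hm₁]
    exact IsPullback.of_hasPullback f (v ≫ q)
  have h2 : IsPullback b (pullback.lift (b ≫ a) p' w') (pullback.lift a p w) m := by
    refine IsPullback.of_bot ?_ ?_ h1
    · rwa [pullback.lift_snd, pullback.lift_snd]
    · apply pullback.hom_ext
      · rw [Category.assoc, Category.assoc, hm₁, pullback.lift_fst, pullback.lift_fst]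
      · rw [Category.assoc, Category.assoc, hm₂, pullback.lift_snd, pullback.lift_snd_assoc, h.w]
  exact MorphismProperty.of_isPullback (P := @IsClosedImmersion) h2 inferInstance

end BaseChange

/-! ### Reduction to a local or complete local base -/

variable {k : Type u} [Field k]

lemma surjective_of_Spec_map_comp_eq_id {A : CommRingCat.{u}} {q : Spec A ⟶ Spec (.of k)}
    {ε : A ⟶ .of k} (h : Spec.map ε ≫ q = 𝟙 _) : Function.Surjective ε.hom := by
  obtain ⟨δ, rfl⟩ := Spec.map_surjective q
  rw [← Spec.map_comp, ← Spec.map_id] at h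
  have h' : δ ≫ ε = 𝟙 _ := Spec.map_injective h
  exact fun c => ⟨δ.hom c, ConcreteCategory.congr_hom h' c⟩

/-- A locally Noetherian irreducible scheme is dominated by the local scheme at a rational point. -/
theorem exists_spec_local (T : Scheme.{u}) [IrreducibleSpace T] [IsLocallyNoetherian T]
    (t : Spec (.of k) ⟶ T) : ∃ (A : Type u) (_ : CommRing A) (_ : IsLocalRing A)
      (_ : IsNoetherianRing A) (_ : IrreducibleSpace (Spec (.of A))) (v : Spec (.of A) ⟶ T)
      (t' : Spec (.of k) ⟶ Spec (.of A)),
      t' ≫ v = t ∧ v (genericPoint (Spec (.of A))) = genericPoint T := by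
  let y := t (IsLocalRing.closedPoint k)
  have hη : genericPoint T ∈ Set.range (T.fromSpecStalk y) := by
    rw [Scheme.range_fromSpecStalk]
    exact (genericPoint_spec T).specializes trivial
  obtain ⟨ξ, hξ⟩ := hη
  have hgen := isGenericPoint_of_isPreimmersion _ hξ
  have : IrreducibleSpace (Spec (T.presheaf.stalk y)) := hgen.irreducibleSpace
  exact ⟨T.presheaf.stalk y, inferInstance, inferInstance, inferInstance, this, T.fromSpecStalk y,
    Spec.map (Scheme.stalkClosedPointTo t), Scheme.Spec_stalkClosedPointTo_fromSpecStalk t,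
    map_genericPoint_of_isGenericPoint _ hgen hξ⟩

/-- A locally Noetherian irreducible scheme is dominated by the spectrum of a complete Noetherian
local ring at a rational point. -/
theorem exists_spec_complete (T : Scheme.{u}) [IrreducibleSpace T] [IsLocallyNoetherian T]
    {q : T ⟶ Spec (.of k)} {t : Spec (.of k) ⟶ T} (h : t ≫ q = 𝟙 _) :
    ∃ (A : Type u) (_ : CommRing A) (_ : IsLocalRing A)
      (_ : IsNoetherianRing A) (_ : IrreducibleSpace (Spec (.of A))) (v : Spec (.of A) ⟶ T)
      (t' : Spec (.of k) ⟶ Spec (.of A)), IsAdicComplete (IsLocalRing.maximalIdeal A) A ∧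
      t' ≫ v = t ∧ v (genericPoint (Spec (.of A))) = genericPoint T := by
  obtain ⟨A, _, _, _, _, v, t', rfl, hv⟩ := exists_spec_local T t
  obtain ⟨ε, rfl⟩ := Spec.map_surjective t'
  have : (nilradical A).IsPrime :=
    (PrimeSpectrum.irreducibleSpace_iff_isPrime_nilradical (R := A)).mp ‹_›
  obtain ⟨B, _, _, _, _, φ, hB, hker, H⟩ := exists_isAdicComplete_domain A
  have hε := surjective_of_Spec_map_comp_eq_id (q := v ≫ q) (by rwa [Category.assoc] at h)
  obtain ⟨ε', hε'⟩ := H (κ := k) ε.hom hε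
  have : IrreducibleSpace (Spec (.of B)) := inferInstance
  refine ⟨B, inferInstance, inferInstance, inferInstance, this,
    Spec.map (CommRingCat.ofHom φ) ≫ v, Spec.map (CommRingCat.ofHom ε'), hB, ?_, ?_⟩
  · rw [← Spec.map_comp_assoc]
    congr 2
    ext1
    exact hε'
  -- The generic point of the domain `B` maps to `ker φ`, the nilradical of `A`; it lies in every
  -- prime, so it is the generic point of `Spec A`.
  · rw [Scheme.Hom.comp_apply, ← hv, genericPoint_eq_bot_of_affine]
    congr 1
    refine ((genericPoint_spec (Spec (.of A))).eq ?_).symm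
    rw [isGenericPoint_iff_specializes]
    refine fun s => ⟨fun _ => trivial, fun _ => (PrimeSpectrum.le_iff_specializes _ _).mp ?_⟩
    change Ideal.comap φ ⊥ ≤ s.asIdeal
    rw [← RingHom.ker_eq_comap_bot, hker]
    exact nilradical_le_prime _ (H := PrimeSpectrum.isPrime s)


/-! ### Equality of morphisms on thickenings, and closed immersions detected on the special fibre -/

open IsLocalRing

/-- The ring homomorphism to global sections corresponding to a morphism to `Spec B`. -/
def toΓ {R : Scheme.{u}} {B : CommRingCat.{u}} (e : R ⟶ Spec B) : B ⟶ Γ(R, ⊤) :=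
  (Scheme.ΓSpecIso B).inv ≫ e.appTop

lemma toSpecΓ_map_toΓ {R : Scheme.{u}} {B : CommRingCat.{u}} (e : R ⟶ Spec B) :
    R.toSpecΓ ≫ Spec.map (toΓ e) = e := by
  rw [toΓ, Spec.map_comp, ← Scheme.toSpecΓ_naturality_assoc]
  simp

lemma toΓ_comp_Spec_map {R : Scheme.{u}} {A B : CommRingCat.{u}} (e : R ⟶ Spec B) (φ : A ⟶ B) :
    toΓ (e ≫ Spec.map φ) = φ ≫ toΓ e := by
  simp [toΓ]

lemma toΓ_comp {R Q : Scheme.{u}} {B : CommRingCat.{u}} (v : Q ⟶ R) (e : R ⟶ Spec B) :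
    toΓ (v ≫ e) = toΓ e ≫ v.appTop := by
  simp [toΓ]

lemma isoSpec_inv_appTop (W : Scheme.{u}) [IsAffine W] :
    W.isoSpec.inv.appTop = (Scheme.ΓSpecIso Γ(W, ⊤)).inv := by
  rw [← cancel_mono (Scheme.ΓSpecIso Γ(W, ⊤)).hom, Iso.inv_hom_id, ← Scheme.toSpecΓ_appTop]
  exact (Scheme.Hom.comp_appTop _ _).symm.trans (by simp)

lemma exists_factor_Spec_map {R : Scheme.{u}} {B K : CommRingCat.{u}} (e : R ⟶ Spec B) (ε : B ⟶ K)
    (hε : Function.Surjective ε.hom) (h : RingHom.ker ε.hom ≤ RingHom.ker (toΓ e).hom) :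
    ∃ e' : R ⟶ Spec K, e' ≫ Spec.map ε = e := by
  refine ⟨R.toSpecΓ ≫ Spec.map (CommRingCat.ofHom
    (RingHom.liftOfSurjective ε.hom hε ⟨(toΓ e).hom, h⟩)), ?_⟩
  conv_rhs => rw [← toSpecΓ_map_toΓ e]
  rw [Category.assoc, ← Spec.map_comp]
  congr 2
  ext b
  exact RingHom.liftOfRightInverse_comp_apply _ _ (Function.rightInverse_surjInv hε)
    ⟨(toΓ e).hom, h⟩ b

lemma toΓ_id_injective (B : CommRingCat.{u}) : Function.Injective (toΓ (𝟙 (Spec B))).hom := by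
  simp only [toΓ, Scheme.Hom.id_appTop, Category.comp_id]
  exact ((ConcreteCategory.isIso_iff_bijective _).mp inferInstance).1

lemma toΓ_Spec_map_apply {A B : CommRingCat.{u}} (φ : A ⟶ B) (a : A) :
    (toΓ (Spec.map φ)).hom a = 0 ↔ φ.hom a = 0 := by
  rw [← map_eq_zero_iff _ (toΓ_id_injective B), ← Category.id_comp (Spec.map φ), toΓ_comp_Spec_map]
  rfl

/-- Two morphisms from the spectrum of a ring into a separated scheme agree if they agree on closed
subschemes whose ideals have trivial intersection. -/
theorem hom_ext_of_iInf_eq_bot {X : Scheme.{u}} [X.IsSeparated] {B : CommRingCat.{u}} {ι : Type*}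
    (I : ι → Ideal B) (hI : ⨅ n, I n = ⊥) (v w : Spec B ⟶ X)
    (h : ∀ n, Spec.map (CommRingCat.ofHom (Ideal.Quotient.mk (I n))) ≫ v =
      Spec.map (CommRingCat.ofHom (Ideal.Quotient.mk (I n))) ≫ w) : v = w := by
  -- As `X` is separated, the equalizer is a closed subscheme. It contains every `V(I n)`, so
  -- functions vanishing on it lie in `⨅ n, I n = ⊥`.
  let E := equalizer.ι v w
  suffices IsIso E from eq_of_epi_equalizer
  apply IsClosedImmersion.isIso_of_injective_of_isAffine
  have : Function.Injective (toΓ E).hom := by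
    rw [injective_iff_map_eq_zero]
    intro b hb
    rw [← Ideal.mem_bot, ← hI, Ideal.mem_iInf]
    intro n
    rw [← Ideal.Quotient.eq_zero_iff_mem]
    refine (toΓ_Spec_map_apply (CommRingCat.ofHom (Ideal.Quotient.mk (I n))) b).mp ?_
    have h1 := toΓ_comp (equalizer.lift _ (h n)) E
    rw [equalizer.lift_ι] at h1
    rw [h1]
    change (equalizer.lift _ (h n)).appTop.hom ((toΓ E).hom b) = 0
    rw [hb, map_zero]
  have h4 : E.appTop = (Scheme.ΓSpecIso B).hom ≫ toΓ E := by simp [toΓ]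
  rw [h4]
  exact this.comp ((ConcreteCategory.isIso_iff_bijective _).mp inferInstance).1

/-- Every `c` differs from `b (d c)` by an element of `ker d`, so `C = b(B) + 𝔪_A C`, and Nakayama
over `A` gives `C = b(B)`. -/
lemma surjective_of_section_of_ker_le {A B C : Type*} [CommRing A] [IsLocalRing A] [CommRing B]
    [CommRing C] (φ : A →+* B) (b : B →+* C) (d : C →+* B) (hdb : d.comp b = RingHom.id B)
    (hφ : (b.comp φ).Finite) (hd : RingHom.ker d ≤ (maximalIdeal A).map (b.comp φ)) :
    Function.Surjective b := by
  let _ := φ.toAlgebra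
  let _ := (b.comp φ).toAlgebra
  have : Module.Finite A C := hφ
  let b' : B →ₐ[A] C := { b with commutes' := fun _ => rfl }
  suffices ⊤ ≤ LinearMap.range b'.toLinearMap by
    intro c
    exact this (Submodule.mem_top (x := c))
  refine Submodule.le_of_le_smul_of_le_jacobson_bot Module.Finite.fg_top
    (maximalIdeal_le_jacobson _) fun c _ => ?_
  have hc : c - b (d c) ∈ (maximalIdeal A).map (b.comp φ) := hd (by
    rw [RingHom.mem_ker, map_sub, ← RingHom.comp_apply, hdb, RingHom.id_apply, sub_self])
  have e : c = b (d c) + (c - b (d c)) := by ring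
  rw [e]
  refine Submodule.add_mem_sup ⟨d c, rfl⟩ ?_
  rw [Ideal.smul_top_eq_map]
  exact hc

/-- Over the closed point of the base both projections of the kernel pair `W` factor through `R`,
where `e ≫ h` is a monomorphism. Hence they agree there, and the special fibre of `W` lies in the
diagonal. -/
lemma ker_appTop_le_of_mono_fibre {A : Type u} [CommRing A] [IsLocalRing A]
    {R Y Z W : Scheme.{u}} {g : R ⟶ Spec (.of k)} {ε : CommRingCat.of A ⟶ .of k}
    (hε : Function.Surjective ε.hom) {p : Z ⟶ Spec (.of A)} {e : R ⟶ Z}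
    (hR : IsPullback e g p (Spec.map ε)) (h : Z ⟶ Y) (y : Y ⟶ Spec (.of A))
    (hy : h ≫ y = p) [Mono (e ≫ h)] {π₁ π₂ : W ⟶ Z} (hW : IsPullback π₁ π₂ h h) [IsAffine W]
    (Δ : Z ⟶ W) (hΔ₁ : Δ ≫ π₁ = 𝟙 Z) (hΔ₂ : Δ ≫ π₂ = 𝟙 Z) :
    RingHom.ker Δ.appTop.hom ≤ (maximalIdeal A).map (toΓ (π₁ ≫ p)).hom := by
  set J := (maximalIdeal A).map (toΓ (π₁ ≫ p)).hom with hJ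
  obtain ⟨v, hvJ⟩ : ∃ v : Spec (.of (Γ(W, ⊤) ⧸ J)) ⟶ W, RingHom.ker v.appTop.hom = J := by
    refine ⟨Spec.map (CommRingCat.ofHom (Ideal.Quotient.mk J)) ≫ W.isoSpec.inv, ?_⟩
    have hv : (Spec.map (CommRingCat.ofHom (Ideal.Quotient.mk J)) ≫ W.isoSpec.inv).appTop =
        toΓ (Spec.map (CommRingCat.ofHom (Ideal.Quotient.mk J))) := by
      rw [Scheme.Hom.comp_appTop, isoSpec_inv_appTop]
      rfl
    ext c
    rw [hv, RingHom.mem_ker, toΓ_Spec_map_apply]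
    exact Ideal.Quotient.eq_zero_iff_mem
  obtain ⟨s, hs⟩ : ∃ s, s ≫ Spec.map ε = v ≫ π₁ ≫ p := by
    refine exists_factor_Spec_map _ ε hε ?_
    rw [ker_eq_maximalIdeal _ hε, toΓ_comp]
    intro a ha
    rw [RingHom.mem_ker, CommRingCat.comp_apply, ← RingHom.mem_ker, hvJ]
    exact Ideal.mem_map_of_mem _ ha
  have hs₁ : (v ≫ π₁) ≫ p = s ≫ Spec.map ε := by rw [hs, Category.assoc]
  have hs₂ : (v ≫ π₂) ≫ p = s ≫ Spec.map ε := by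
    rw [← hs₁, ← hy, Category.assoc, Category.assoc, hW.w_assoc]
  have h12 : hR.lift _ _ hs₁ = hR.lift _ _ hs₂ := by
    rw [← cancel_mono (e ≫ h), hR.lift_fst_assoc, hR.lift_fst_assoc, Category.assoc,
      Category.assoc, hW.w]
  have hv12 : v ≫ π₁ = v ≫ π₂ := by
    rw [← hR.lift_fst _ _ hs₁, h12, hR.lift_fst]
  have hvΔ : v = (v ≫ π₁) ≫ Δ := by
    apply hW.hom_ext
    · rw [Category.assoc, hΔ₁, Category.comp_id]
    · rw [Category.assoc, hΔ₂, Category.comp_id, hv12]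
  intro c hc
  rw [← hvJ, RingHom.mem_ker, hvΔ, Scheme.Hom.comp_appTop, CommRingCat.comp_apply]
  rw [RingHom.mem_ker] at hc
  rw [hc, map_zero]

/-- A finite scheme over a local base which maps to a separated scheme over the base by a
monomorphism on the special fibre is a closed subscheme. -/
theorem isClosedImmersion_of_mono_fibre {A : Type u} [CommRing A] [IsLocalRing A]
    {R Y Z : Scheme.{u}} {g : R ⟶ Spec (.of k)} {ε : CommRingCat.of A ⟶ .of k}
    (hε : Function.Surjective ε.hom) {p : Z ⟶ Spec (.of A)} [IsFinite p] {e : R ⟶ Z}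
    (hR : IsPullback e g p (Spec.map ε)) (h : Z ⟶ Y) (y : Y ⟶ Spec (.of A)) [IsSeparated y]
    (hy : h ≫ y = p) [Mono (e ≫ h)] : IsClosedImmersion h := by
  have hfin : IsFinite h := by
    have : IsFinite (h ≫ y) := by rwa [hy]
    exact .of_comp h y
  rw [IsClosedImmersion.iff_isFinite_and_mono]
  refine ⟨hfin, ?_⟩
  -- It suffices that `π₁` be an isomorphism. The diagonal is a section of it, so it is enough that
  -- `π₁` be a closed immersion, that is, surjective on functions.
  obtain ⟨W, π₁, π₂, hW⟩ : ∃ (W : Scheme.{u}) (π₁ π₂ : W ⟶ Z), IsPullback π₁ π₂ h h :=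
    ⟨_, _, _, IsPullback.of_hasPullback h h⟩
  have hπ₁ : IsFinite π₁ := MorphismProperty.of_isPullback (P := @IsFinite) hW.flip hfin
  have hΔ₁ : hW.lift (𝟙 Z) (𝟙 Z) rfl ≫ π₁ = 𝟙 Z := hW.lift_fst _ _ _
  have hZ : IsAffine Z := isAffine_of_isAffineHom p
  have : IsAffine W := isAffine_of_isAffineHom π₁
  have h1 : IsClosedImmersion π₁ := by
    refine .of_surjective_of_isAffine π₁ ?_
    have hp : toΓ (π₁ ≫ p) = toΓ p ≫ π₁.appTop := toΓ_comp _ _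
    refine surjective_of_section_of_ker_le (toΓ p).hom π₁.appTop.hom
      (hW.lift (𝟙 Z) (𝟙 Z) rfl).appTop.hom ?_ ?_ ?_
    · rw [← CommRingCat.hom_comp, ← Scheme.Hom.comp_appTop, hΔ₁]
      rfl
    · rw [← CommRingCat.hom_comp, ← hp, ← IsFinite.SpecMap_iff]
      have : W.toSpecΓ ≫ Spec.map (toΓ (π₁ ≫ p)) = π₁ ≫ p := toSpecΓ_map_toΓ _
      rw [← IsIso.eq_inv_comp] at this
      rw [this]
      infer_instance
    · rw [← CommRingCat.hom_comp, ← hp]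
      exact ker_appTop_le_of_mono_fibre hε hR h y hy hW _ hΔ₁ (hW.lift_snd _ _ _)
  have h2 : IsIso π₁ := ⟨hW.lift (𝟙 Z) (𝟙 Z) rfl, by
    rw [← cancel_mono π₁, Category.assoc, hΔ₁, Category.comp_id, Category.id_comp], hΔ₁⟩
  exact IsKernelPair.mono_of_isIso_fst hW


/-! ### Functoriality of lifts of Artinian schemes to completed local rings -/

section LocalLift

variable {A B B' : Type u} [CommRing A] [IsLocalRing A] [CommRing B] [IsLocalRing B]
  [IsArtinianRing B] [CommRing B'] [IsLocalRing B'] [IsArtinianRing B']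

/-- Frees `completionLift` from the chosen exponent: any sufficiently precise approximation of `x`
computes its value. Lifts defined with different exponents can then be compared. -/
lemma completionLift_eq (φ : A →+* B) [IsLocalHom φ] (x : AdicCompletion (maximalIdeal A) A) :
    ∃ N, ∀ n ≥ N, ∀ a, AdicCompletion.evalₐ (maximalIdeal A) n x =
      Ideal.Quotient.mk (maximalIdeal A ^ n) a → completionLift φ x = φ a := by
  refine ⟨(exists_pow_map_eq_zero φ).choose, fun n hn a ha => ?_⟩
  obtain ⟨b, hb⟩ := AdicCompletion.exists_forall_evalₐ_eq (maximalIdeal A) n x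
  have h1 : completionLift φ x = φ b := by
    simp [completionLift, hb _ hn]
  have h2 := (exists_pow_map_eq_zero φ).choose_spec
  rw [h1, ← sub_eq_zero, ← map_sub]
  apply h2
  apply Ideal.pow_le_pow_right hn
  rw [← Ideal.Quotient.eq, ← hb n le_rfl, ha]

lemma comp_completionLift (φ : A →+* B) [IsLocalHom φ] (ψ : B →+* B') (φ' : A →+* B')
    [IsLocalHom φ']     (h : ψ.comp φ = φ') : ψ.comp (completionLift φ) = completionLift φ' := by
  ext x
  obtain ⟨N, hN⟩ := completionLift_eq φ x
  obtain ⟨N', hN'⟩ := completionLift_eq φ' x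
  obtain ⟨a, ha⟩ := AdicCompletion.exists_forall_evalₐ_eq (maximalIdeal A) (max N N') x
  rw [RingHom.comp_apply, hN _ (le_max_left _ _) a (ha _ le_rfl),
    hN' _ (le_max_right _ _) a (ha _ le_rfl), ← h, RingHom.comp_apply]

end LocalLift

section ArtinianLift

variable {X R Q : Scheme.{u}} {n : ℕ}

lemma stalkHom_comp_stalkMap (i : R ⟶ X) (w : Q ⟶ R) (r : Q) {y : X} (e : y = i (w r))
    (e' : y = (w ≫ i) r) :
    stalkHom i (w r) e ≫ w.stalkMap r = stalkHom (w ≫ i) r e' := by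
  rw [stalkHom, stalkHom, Scheme.Hom.stalkMap_comp, Category.assoc]
  rfl

variable [IsLocallyArtinian R] [IsLocallyArtinian Q]

lemma completedStalkHom_comp_stalkMap (i : R ⟶ X) (w : Q ⟶ R) (r : Q) {y : X} (e : y = i (w r))
    (e' : y = (w ≫ i) r) :
    completedStalkHom i (w r) e ≫ w.stalkMap r = completedStalkHom (w ≫ i) r e' :=
  CommRingCat.hom_ext (comp_completionLift (A := X.presheaf.stalk y)
    (B := R.presheaf.stalk (w r)) (B' := Q.presheaf.stalk r) (stalkHom i (w r) e).hom
      (w.stalkMap r).hom (stalkHom (w ≫ i) r e').hom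
      congr(($(stalkHom_comp_stalkMap i w r e e')).hom))

/-- Distinctness of the points `x a` makes the index chosen in `supportIndex` irrelevant, which is
what allows lifts along different schemes to be compared. -/
lemma formalLiftAt_eq (i : R ⟶ X) {x : Fin n → X} (hx : Function.Injective x)
    (h : Set.range i = Set.range x) (r : R) {a : Fin n} (ha : x a = i r) :
    formalLiftAt i x h r = Spec.map (completedStalkHom i r ha) ≫
      Sigma.ι (fun a : Fin n => Spec (completedStalk X (x a))) a := by
  obtain rfl : a = supportIndex i x h r := hx (ha.trans (supportIndex_spec i x h r).symm)
  rfl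

/-- The lift of a morphism from a locally Artinian scheme with image `{x 0, x 1, …}` to the formal
neighbourhood of these points. -/
def artinianLift (i : R ⟶ X) (x : Fin n → X) (h : Set.range i = Set.range x) : R ⟶ formalNbhd x :=
  (stalkCover R).glueMorphisms (formalLiftAt i x h) (pullback_fst_eq_snd R _)

lemma fromSpecStalk_artinianLift (i : R ⟶ X) (x : Fin n → X) (h : Set.range i = Set.range x)
    (r : R) : R.fromSpecStalk r ≫ artinianLift i x h = formalLiftAt i x h r :=
  Scheme.Cover.ι_glueMorphisms (stalkCover R) (formalLiftAt i x h) (pullback_fst_eq_snd R _) r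

lemma artinianLift_formalNbhdTo (i : R ⟶ X) (x : Fin n → X) (h : Set.range i = Set.range x) :
    artinianLift i x h ≫ formalNbhdTo x = i := by
  refine Scheme.Cover.hom_ext (stalkCover R) _ _ fun r => ?_
  rw [← Category.assoc]
  exact (congrArg (· ≫ formalNbhdTo x) (fromSpecStalk_artinianLift i x h r)).trans
    (formalLiftAt_formalNbhdTo i x h r)

lemma fromSpecStalk_comp_artinianLift (i : R ⟶ X) {x : Fin n → X} (hx : Function.Injective x)
    (h : Set.range i = Set.range x) (w : Q ⟶ R) (h' : Set.range (w ≫ i) = Set.range x) (r : Q) :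
    Q.fromSpecStalk r ≫ w ≫ artinianLift i x h = formalLiftAt (w ≫ i) x h' r := by
  have ha := supportIndex_spec i x h (w r)
  rw [← Scheme.SpecMap_stalkMap_fromSpecStalk_assoc, fromSpecStalk_artinianLift,
    formalLiftAt_eq i hx h (w r) ha, formalLiftAt_eq (w ≫ i) hx h' r ha, ← Spec.map_comp_assoc,
    completedStalkHom_comp_stalkMap i w r ha ha]

lemma comp_artinianLift (i : R ⟶ X) {x : Fin n → X} (hx : Function.Injective x)
    (h : Set.range i = Set.range x) (w : Q ⟶ R) (h' : Set.range (w ≫ i) = Set.range x) :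
    w ≫ artinianLift i x h = artinianLift (w ≫ i) x h' :=
  Scheme.Cover.hom_ext (stalkCover Q) _ _ fun r =>
    (fromSpecStalk_comp_artinianLift i hx h w h' r).trans
      (fromSpecStalk_artinianLift (w ≫ i) x h' r).symm


end ArtinianLift

/-! ### Lifting finite schemes over a complete local base -/

lemma isArtinianRing_quotient_pow {A B : Type*} [CommRing A] [IsLocalRing A] [IsNoetherianRing A]
    [CommRing B] {φ : A →+* B} (hφ : φ.Finite) (n : ℕ) :
    IsArtinianRing (B ⧸ ((maximalIdeal A).map φ) ^ n) := by
  algebraize [φ]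
  have : IsNoetherianRing B := .of_finite A B
  rw [isArtinianRing_iff_isNoetherianRing_krullDimLE_zero, Ring.krullDimLE_zero_iff]
  refine ⟨inferInstance, fun P hP => ?_⟩
  let π := Ideal.Quotient.mk (((maximalIdeal A).map φ) ^ n)
  have hle : (maximalIdeal A).map φ ≤ P.comap π := by
    refine Ideal.IsPrime.le_of_pow_le (n := n) ?_
    intro b hb
    rw [Ideal.mem_comap, Ideal.Quotient.eq_zero_iff_mem.mpr hb]
    exact P.zero_mem
  -- A prime containing `𝔪_A B` contracts to `𝔪_A`, so it is maximal because `B` is integral over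
  -- `A`.
  have hmax : (P.comap π).IsMaximal := by
    refine Ideal.isMaximal_of_isIntegral_of_isMaximal_comap (R := A) _ ?_
    exact ((maximalIdeal.isMaximal A).eq_of_le (Ideal.IsPrime.ne_top inferInstance)
      (Ideal.map_le_iff_le_comap.mp hle)) ▸ maximalIdeal.isMaximal A
  exact Ideal.map_comap_of_surjective π Ideal.Quotient.mk_surjective P ▸
    (Ideal.map_eq_top_or_isMaximal_of_surjective π Ideal.Quotient.mk_surjective hmax).resolve_left
      (by rw [Ideal.map_comap_of_surjective π Ideal.Quotient.mk_surjective P]; exact hP.ne_top)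

lemma eq_closedPoint_of_maximalIdeal_le {A : Type*} [CommRing A] [IsLocalRing A]
    {y : PrimeSpectrum A} (h : maximalIdeal A ≤ y.asIdeal) : y = closedPoint A :=
  PrimeSpectrum.ext ((maximalIdeal.isMaximal A).eq_of_le y.2.ne_top h).symm

lemma range_comp_eq {A B : CommRingCat.{u}} [IsLocalRing A] {R X : Scheme.{u}}
    {g : R ⟶ Spec (.of k)} {ε : A ⟶ .of k} (hε : Function.Surjective ε.hom) {φ : A ⟶ B}
    {e : R ⟶ Spec B} (hR : IsPullback e g (Spec.map φ) (Spec.map ε)) (a : Spec B ⟶ X)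
    {Q : Scheme.{u}} (π : Q ⟶ Spec B) (hQ : ∃ e' : R ⟶ Q, e' ≫ π = e)
    (hπ : ∀ z : Q, (maximalIdeal A).map φ.hom ≤ (show PrimeSpectrum B from π z).asIdeal) :
    Set.range (π ≫ a) = Set.range (e ≫ a) := by
  obtain ⟨e', rfl⟩ := hQ
  apply Set.Subset.antisymm
  · rintro _ ⟨z, rfl⟩
    have : Spec.map φ (π z) = Spec.map ε (closedPoint k) := by
      refine (eq_closedPoint_of_maximalIdeal_le (Ideal.map_le_iff_le_comap.mp (hπ z))).trans
        (eq_closedPoint_of_maximalIdeal_le ?_).symm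
      rw [← ker_eq_maximalIdeal _ hε]
      exact Ideal.ker_le_comap _
    obtain ⟨r, hr, -⟩ := Scheme.exists_preimage_of_isPullback hR (π z) (closedPoint k) this
    refine ⟨r, ?_⟩
    rw [Scheme.Hom.comp_apply (e' ≫ π) a, Scheme.Hom.comp_apply π a]
    exact congrArg a hr
  · rintro _ ⟨r, rfl⟩
    exact ⟨e' r, by simp⟩

lemma exists_ringHom_of_isAdicComplete {S B : Type*} [CommRing S] [CommRing B] (J : Ideal B)
    [IsAdicComplete J B] (γ : ∀ m : ℕ, S →+* B ⧸ J ^ (m + 1))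
    (hγ : ∀ m, (Ideal.Quotient.factorPow J (Nat.le_succ (m + 1))).comp (γ (m + 1)) = γ m) :
    ∃ ψ : S →+* B, ∀ m, (Ideal.Quotient.mk (J ^ (m + 1))).comp ψ = γ m := by
  have ha : StrictMono fun m : ℕ => m + 1 := fun _ _ h => Nat.succ_lt_succ h
  exact ⟨IsAdicComplete.StrictMono.liftRingHom J ha γ (hγ _),
    fun m => IsAdicComplete.StrictMono.mk_comp_liftRingHom J ha γ (hγ _)⟩

/-- Compatible morphisms from the infinitesimal neighbourhoods of a closed subscheme along which
`Spec B` is complete into an affine scheme extend to `Spec B`. -/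
theorem exists_hom_of_isAdicComplete {B : CommRingCat.{u}} (J : Ideal B) [IsAdicComplete J B]
    {F : Scheme.{u}} [IsAffine F] (l : ∀ m : ℕ, Spec (.of (B ⧸ J ^ (m + 1))) ⟶ F)
    (hl : ∀ m, Spec.map (CommRingCat.ofHom (Ideal.Quotient.factorPow J (Nat.le_succ (m + 1)))) ≫
      l (m + 1) = l m) :
    ∃ c : Spec B ⟶ F,
      ∀ m, Spec.map (CommRingCat.ofHom (Ideal.Quotient.mk (J ^ (m + 1)))) ≫ c = l m := by
  choose γ hγ using fun m => Spec.map_surjective (l m ≫ (F).isoSpec.hom)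
  have hγ' (m : ℕ) : (Ideal.Quotient.factorPow J (Nat.le_succ (m + 1))).comp (γ (m + 1)).hom =
      (γ m).hom := by
    have : γ (m + 1) ≫ CommRingCat.ofHom (Ideal.Quotient.factorPow J (Nat.le_succ _)) = γ m := by
      apply Spec.map_injective
      rw [Spec.map_comp, hγ, hγ, ← Category.assoc, hl]
    exact congrArg CommRingCat.Hom.hom this
  obtain ⟨ψ, hψ⟩ := exists_ringHom_of_isAdicComplete J (fun m => (γ m).hom) hγ'
  refine ⟨Spec.map (CommRingCat.ofHom ψ) ≫ F.isoSpec.inv, fun m => ?_⟩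
  have e : CommRingCat.ofHom ψ ≫ CommRingCat.ofHom (Ideal.Quotient.mk (J ^ (m + 1))) = γ m :=
    CommRingCat.hom_ext (hψ m)
  rw [← Spec.map_comp_assoc, e, hγ, Category.assoc, Iso.hom_inv_id, Category.comp_id]

/-- A morphism to `X` from a finite scheme `Spec B` over a complete Noetherian local ring, whose
special fibre is supported at the points `x a`, lifts to the formal neighbourhood. -/
theorem exists_lift_formalNbhd {A B : CommRingCat.{u}} [IsLocalRing A] [IsNoetherianRing A]
    [IsAdicComplete (maximalIdeal A) A] {R X : Scheme.{u}}
    [IsLocallyArtinian R] [X.IsSeparated] {n : ℕ} {x : Fin n → X} (hx : Function.Injective x)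
    {g : R ⟶ Spec (.of k)} {ε : A ⟶ .of k} (hε : Function.Surjective ε.hom) {φ : A ⟶ B} (hφ : φ.hom.Finite)
    {e : R ⟶ Spec B} (hR : IsPullback e g (Spec.map φ) (Spec.map ε)) (a : Spec B ⟶ X)
    (h : Set.range (e ≫ a) = Set.range x) :
    ∃ c : Spec B ⟶ formalNbhd x, c ≫ formalNbhdTo x = a ∧ e ≫ c = artinianLift (e ≫ a) x h := by
  set J := (maximalIdeal A).map φ.hom with hJ
  have hB : IsAdicComplete J B := by
    algebraize [φ.hom]
    have : IsAdicComplete (maximalIdeal A) B := .of_finite_of_isNoetherianRing _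
    exact (IsAdicComplete.map_algebraMap_iff (R := A) (S := B) (M := B)
      (I := maximalIdeal A)).mpr this
  -- The exponent is `m + 1` because `B / J ^ 0` is zero: `R` need not factor through its empty
  -- spectrum, nor need the latter have the support required by `artinianLift`.
  let Q (m : ℕ) : Scheme.{u} := Spec (.of (B ⧸ J ^ (m + 1)))
  let π (m : ℕ) : Q m ⟶ Spec B := Spec.map (CommRingCat.ofHom (Ideal.Quotient.mk _))
  have hQ (m : ℕ) : IsLocallyArtinian (Q m) :=
    Scheme.isLocallyArtinianScheme_Spec.mpr (isArtinianRing_quotient_pow hφ (m + 1))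
  have heΓ : J ≤ RingHom.ker (toΓ e).hom := by
    rw [hJ, Ideal.map_le_iff_le_comap, ← ker_eq_maximalIdeal _ hε]
    intro b hb
    have h1 : φ ≫ toΓ e = toΓ (Spec.map ε) ≫ g.appTop := by
      rw [← toΓ_comp_Spec_map, hR.w, toΓ_comp]
    have h2 := ConcreteCategory.congr_hom h1 b
    have h3 : (toΓ (Spec.map ε)).hom b = 0 := (toΓ_Spec_map_apply ε b).mpr hb
    refine h2.trans ?_
    change g.appTop.hom ((toΓ (Spec.map ε)).hom b) = 0
    rw [h3, map_zero]
  have he (m : ℕ) : ∃ e' : R ⟶ Q m, e' ≫ π m = e := by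
    refine exists_factor_Spec_map e _ Ideal.Quotient.mk_surjective ?_
    rw [CommRingCat.hom_ofHom, Ideal.mk_ker]
    exact (Ideal.pow_le_self m.succ_ne_zero).trans heΓ
  have hrange (m : ℕ) : Set.range (π m ≫ a) = Set.range x := by
    refine (range_comp_eq hε hR a (π m) (he m) fun z => ?_).trans h
    refine Ideal.IsPrime.le_of_pow_le (n := m + 1) (hP := PrimeSpectrum.isPrime _) ?_
    exact (Ideal.mk_ker (I := J ^ (m + 1))).ge.trans (Ideal.ker_le_comap _)
  let l (m : ℕ) : Q m ⟶ formalNbhd x := artinianLift (π m ≫ a) x (hrange m)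
  let τ (m : ℕ) : Q m ⟶ Q (m + 1) :=
    Spec.map (CommRingCat.ofHom (Ideal.Quotient.factorPow J (Nat.le_succ _)))
  have hτ (m : ℕ) : τ m ≫ π (m + 1) = π m := by
    simp only [τ, π, ← Spec.map_comp]
    congr 1
  have hl (m : ℕ) : τ m ≫ l (m + 1) = l m := by
    have e₁ : τ m ≫ π (m + 1) ≫ a = π m ≫ a := by rw [← Category.assoc, hτ]
    have := comp_artinianLift (π (m + 1) ≫ a) hx (hrange _) (τ m) (by rw [e₁]; exact hrange m)
    refine this.trans ?_
    congr 1
  obtain ⟨c, hc⟩ := exists_hom_of_isAdicComplete J l hl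
  refine ⟨c, ?_, ?_⟩
  · refine hom_ext_of_iInf_eq_bot (fun m => J ^ (m + 1)) ?_ _ _ fun m => ?_
    · refine eq_bot_iff.mpr fun b hb => IsHausdorff.haus hB.toIsHausdorff b fun m => ?_
      rw [SModEq.zero, smul_eq_mul, Ideal.mul_top]
      exact Ideal.pow_le_pow_right (Nat.le_succ m) ((Ideal.mem_iInf.mp hb) m)
    · change π m ≫ c ≫ _ = π m ≫ a
      rw [← Category.assoc, hc, artinianLift_formalNbhdTo]
  -- `R` factors through the first truncation, where `c` is an Artinian lift by construction; such
  -- lifts are compatible with composition.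
  · obtain ⟨e₀, h₀⟩ := he 0
    subst h₀
    rw [Category.assoc, hc]
    exact comp_artinianLift (π 0 ≫ a) hx (hrange 0) e₀ h


/-! ### The two implications -/

variable {R X : Scheme.{u}} {f : X ⟶ Spec (.of k)} {i : R ⟶ X}

lemma isSmoothableIn_of_lift {T Z : Scheme.{u}} [IrreducibleSpace T] {q : T ⟶ Spec (.of k)}
    {t : Spec (.of k) ⟶ T} {a : Z ⟶ X} {p : Z ⟶ T} (w : a ≫ f = p ≫ q)
    (hc : IsClosedImmersion (pullback.lift a p w)) {e : R ⟶ Z} (he : e ≫ a = i)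
    (H : IsAbstractSmoothing (i ≫ f) q t p e) : IsSmoothableIn f i :=
  ⟨T, Z, inferInstance, q, t, pullback.lift a p w, e, hc, by rwa [pullback.lift_snd],
    by rwa [pullback.lift_fst]⟩

lemma isSeparated_of_isSeparated_of_isAffine {S : Scheme.{u}} [IsAffine S] (f : X ⟶ S)
    [IsSeparated f] : X.IsSeparated := by
  rw [Scheme.isSeparated_iff, ← terminal.comp_from f]
  infer_instance

/-- A smoothing restricts along a morphism to its base from a local scheme, and is then affine. -/
theorem exists_affine_smoothing {T Z : Scheme.{u}} [IrreducibleSpace T] {q : T ⟶ Spec (.of k)}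
    {t : Spec (.of k) ⟶ T} {j : Z ⟶ pullback f q} [IsClosedImmersion j] {e : R ⟶ Z}
    (H : IsAbstractSmoothing (i ≫ f) q t (j ≫ pullback.snd f q) e)
    (hi : e ≫ j ≫ pullback.fst f q = i) {A : CommRingCat.{u}} [IsNoetherianRing A]
    [IrreducibleSpace (Spec A)] {v : Spec A ⟶ T} (hv : v (genericPoint (Spec A)) = genericPoint T)
    {ε : A ⟶ .of k} (ht : Spec.map ε ≫ v = t) :
    ∃ (B : CommRingCat.{u}) (φ : A ⟶ B) (a : Spec B ⟶ X) (e' : R ⟶ Spec B)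
      (w : a ≫ f = Spec.map φ ≫ v ≫ q), IsClosedImmersion (pullback.lift a (Spec.map φ) w) ∧
      e' ≫ a = i ∧ IsAbstractSmoothing (i ≫ f) (v ≫ q) (Spec.map ε) (Spec.map φ) e' := by
  have hfin := H.isFinite
  let P := pullback (j ≫ pullback.snd f q) v
  have hP : IsAffine P := isAffine_of_isAffineHom (pullback.snd (j ≫ pullback.snd f q) v)
  obtain ⟨φ, hφ⟩ := Spec.map_surjective (P.isoSpec.inv ≫ pullback.snd (j ≫ pullback.snd f q) v)
  have hsq : IsPullback (P.isoSpec.inv ≫ pullback.fst (j ≫ pullback.snd f q) v) (Spec.map φ)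
      (j ≫ pullback.snd f q) v := by
    refine IsPullback.of_iso (IsPullback.of_hasPullback (j ≫ pullback.snd f q) v) P.isoSpec
      (Iso.refl _) (Iso.refl _) (Iso.refl _) ?_ ?_ ?_ ?_
    · rw [Iso.hom_inv_id_assoc]; exact Category.comp_id _
    · rw [hφ, Iso.hom_inv_id_assoc]; exact Category.comp_id _
    · exact (Category.comp_id _).trans (Category.id_comp _).symm
    · exact (Category.comp_id _).trans (Category.id_comp _).symm
  generalize P.isoSpec.inv ≫ pullback.fst (j ≫ pullback.snd f q) v = b at hsq
  obtain ⟨e', he', H'⟩ := H.exists_baseChange hv ht hsq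
  have w₀ : (j ≫ pullback.fst f q) ≫ f = (j ≫ pullback.snd f q) ≫ q := by
    rw [Category.assoc, Category.assoc, pullback.condition]
  have w : (b ≫ j ≫ pullback.fst f q) ≫ f = Spec.map φ ≫ v ≫ q := by
    rw [Category.assoc, w₀, hsq.w_assoc]
  have hj : pullback.lift _ _ w₀ = j := by
    apply pullback.hom_ext
    · rw [pullback.lift_fst]
    · rw [pullback.lift_snd]
  have hc : IsClosedImmersion (pullback.lift _ _ w₀) := by rwa [hj]
  exact ⟨_, φ, b ≫ j ≫ pullback.fst f q, e', w, isClosedImmersion_lift_baseChange w₀ hsq w,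
    by rw [← Category.assoc, he', hi], H'⟩

theorem IsSmoothableIn.to_formalNbhd [IsSeparated f] [IsFinite (i ≫ f)] {n : ℕ} {x : Fin n → X}
    (hx : Function.Injective x) (hsupp : Set.range i = Set.range x) (h : IsSmoothableIn f i) :
    IsSmoothableIn (formalNbhdTo x ≫ f) (formalLift f i x hsupp) := by
  obtain ⟨T, Z, _, q, t, j, e, hj, H, hi⟩ := h
  have := H.isLocallyNoetherian
  obtain ⟨A, _, _, _, _, v, t', hA, ht, hv⟩ := exists_spec_complete T H.rational
  obtain ⟨ε, rfl⟩ := Spec.map_surjective t'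
  obtain ⟨B, φ, a, e', w, hc, he', H'⟩ := exists_affine_smoothing H hi hv ht
  have hε := surjective_of_Spec_map_comp_eq_id H'.rational
  have hφ := (IsFinite.SpecMap_iff φ).mp H'.isFinite
  have : IsLocallyArtinian R := isLocallyArtinian_of_isFinite f i
  have : X.IsSeparated := isSeparated_of_isSeparated_of_isAffine f
  obtain ⟨c, hca, hce⟩ :=
    exists_lift_formalNbhd (A := .of A) hx hε hφ H'.fibre a (by rw [he', hsupp])
  subst hca he'
  have w' : c ≫ formalNbhdTo x ≫ f = Spec.map φ ≫ v ≫ q := by rw [← w, Category.assoc]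
  have hif : formalLift f (e' ≫ c ≫ formalNbhdTo x) x hsupp ≫ formalNbhdTo x ≫ f =
      (e' ≫ c ≫ formalNbhdTo x) ≫ f := by
    rw [← Category.assoc, formalLift_formalNbhdTo]
  -- `hce` speaks of `artinianLift`, which is `formalLift` by definition.
  refine isSmoothableIn_of_lift (t := Spec.map ε) w' ?_ hce (by rwa [hif])
  let m : pullback (formalNbhdTo x ≫ f) (v ≫ q) ⟶ pullback f (v ≫ q) :=
    pullback.lift (pullback.fst _ _ ≫ formalNbhdTo x) (pullback.snd _ _)
      (by rw [Category.assoc, pullback.condition])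
  -- A morphism that becomes a closed immersion after composition with a separated one is itself a
  -- closed immersion. Here the composite is the given embedding into `X ×ₖ Spec A`.
  have hm : IsSeparated m := by
    have : IsSeparated (formalNbhdTo x ≫ f) := inferInstance
    have : IsSeparated (m ≫ pullback.snd _ _) := by
      rw [pullback.lift_snd]
      infer_instance
    exact .of_comp m (pullback.snd _ _)
  have : IsClosedImmersion (pullback.lift c (Spec.map φ) w' ≫ m) := by
    convert hc using 1
    apply pullback.hom_ext
    · rw [Category.assoc, pullback.lift_fst, pullback.lift_fst_assoc, pullback.lift_fst]
    · rw [Category.assoc, pullback.lift_snd, pullback.lift_snd, pullback.lift_snd]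
  exact .of_comp _ m

theorem IsSmoothableIn.of_formalNbhd [IsSeparated f] [IsClosedImmersion i] [IsFinite (i ≫ f)]
    {n : ℕ} {x : Fin n → X} (hsupp : Set.range i = Set.range x)
    (h : IsSmoothableIn (formalNbhdTo x ≫ f) (formalLift f i x hsupp)) :
    IsSmoothableIn f i := by
  obtain ⟨T, Z, _, q, t, j, e, hj, H, hi⟩ := h
  have := H.isLocallyNoetherian
  obtain ⟨A, _, _, _, _, v, t', ht, hv⟩ := exists_spec_local T t
  obtain ⟨ε, rfl⟩ := Spec.map_surjective t'
  obtain ⟨B, φ, c, e', w, hc, he', H'⟩ := exists_affine_smoothing H hi hv ht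
  have hε := surjective_of_Spec_map_comp_eq_id H'.rational
  have hei : e' ≫ c ≫ formalNbhdTo x = i := by
    rw [← Category.assoc, he', formalLift_formalNbhdTo]
  have w' : (c ≫ formalNbhdTo x) ≫ f = Spec.map φ ≫ v ≫ q := by rw [← w, Category.assoc]
  have hif : formalLift f i x hsupp ≫ formalNbhdTo x ≫ f = i ≫ f := by
    rw [← Category.assoc, formalLift_formalNbhdTo]
  rw [hif] at H'
  have := H'.isFinite
  -- Projecting further to `X` gives `i`, which is already a monomorphism.
  have : Mono (e' ≫ pullback.lift (c ≫ formalNbhdTo x) (Spec.map φ) w') := by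
    have h1 : (e' ≫ pullback.lift (c ≫ formalNbhdTo x) (Spec.map φ) w') ≫ pullback.fst _ _ = i := by
      rw [Category.assoc, pullback.lift_fst, hei]
    have : Mono ((e' ≫ pullback.lift (c ≫ formalNbhdTo x) (Spec.map φ) w') ≫ pullback.fst _ _) := by
      rw [h1]
      infer_instance
    exact mono_of_mono _ (pullback.fst _ _)
  exact isSmoothableIn_of_lift w' (isClosedImmersion_of_mono_fibre hε H'.fibre _
    (pullback.snd f (v ≫ q)) (pullback.lift_snd _ _ _)) hei H'

end Smoothability

end

theorem mainTheorem9 {k : Type u} [Field k] {X R : Scheme.{u}}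
    (f : X ⟶ Spec (.of k)) [IsSeparated f]
    (i : R ⟶ X) [IsClosedImmersion i] [IsFinite (i ≫ f)]
    {n : ℕ} (x : Fin n → X) (hx : Function.Injective x) (hsupp : Set.range i = Set.range x) :
    Smoothability.IsSmoothableIn f i ↔
      Smoothability.IsSmoothableIn (Smoothability.formalNbhdTo x ≫ f)
        (Smoothability.formalLift f i x hsupp) :=
  ⟨.to_formalNbhd hx hsupp, .of_formalNbhd hsupp⟩
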